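/- For points $p\ne q$ in the Euclidean plane let $D[p,q]$ be the closed disk with diameter $pq$. The Gabriel graph $GG(S)$ of a finite set $S$ of points in the plane has vertex set $S$, and two distinct points $p,q\in S$ are adjacent if and only if $D[p,q]$ contains no point of $S\setminus\{p,q\}$. A finite set $K$ of points in the plane blocks $GG(P)$ if $P$ is an independent set in $GG(P\cup K)$. Theorem. For every finite set $P$ of $n$ points in the plane, every set $K$ of points that blocks $GG(P)$ has at least $\lceil\frac{n-1}{3}\rceil$ points. The bound is tight: there are a set $P$ of $n=13$ points in the plane and a set $K$ of $\lceil\frac{n-1}{3}\rceil=4$ points, disjoint from $P$, that blocks $GG(P)$. -/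

import Mathlib

/-- The Euclidean plane. -/
abbrev Plane : Type := EuclideanSpace ℝ (Fin 2)

/-- The closed disk that has the segment `pq` as a diameter. -/
noncomputable def diametralDisk (p q : Plane) : Set Plane :=
  Metric.closedBall (midpoint ℝ p q) (dist p q / 2)

theorem diametralDisk_comm (p q : Plane) : diametralDisk p q = diametralDisk q p := by
  unfold diametralDisk
  rw [midpoint_comm, dist_comm]

/-- The order-`k` Gabriel graph on the point set `S`: the vertices are the points of `S`, and two
distinct points `p`, `q` are adjacent iff the closed disk with diameter `pq` contains at most `k`
points of `S \ {p, q}`. -/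
def kGabrielGraph (k : ℕ) (S : Set Plane) : SimpleGraph S where
  Adj p q := p ≠ q ∧ ((S \ {(p : Plane), (q : Plane)}) ∩ diametralDisk p q).encard ≤ k
  symm := ⟨fun p q h => ⟨h.1.symm, by
    rw [diametralDisk_comm, Set.pair_comm]
    exact h.2⟩⟩
  loopless := ⟨fun _ h => h.1 rfl⟩

/-- The Gabriel graph on `S`, which is the order-`0` Gabriel graph. -/
def gabrielGraph (S : Set Plane) : SimpleGraph S := kGabrielGraph 0 S

/-- `K` blocks the Gabriel graph of `P`: the points of `P` form an independent set in the Gabriel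
graph of `P ∪ K`. -/
def BlocksGabriel (P K : Set Plane) : Prop :=
  (gabrielGraph (P ∪ K)).IsIndepSet {v | (v : Plane) ∈ P}

/-! Take a Euclidean minimum spanning tree of `P`. A point of `P` in the diametral disk of a tree
edge `ab` would be closer to both `a` and `b` than they are to each other, so an exchange would
shorten the tree. Hence each of the n - 1 disks contains a point of `K` outside `P`, and it suffices
that no such point `x` serves more than three edges. Delete the edges served by `x` and pick in each
component the vertex nearest to `x`. Minimality of the tree forces the directions from `x` to these
representatives to differ pairwise by more than π/3, and all but the overall nearest to lie in one
closed half-plane. So at most three others exist: at most four components, at most three deleted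
edges. -/

namespace SimpleGraph

/-! ### Minimum spanning trees and edge deletion -/

variable {V : Type*}

/-- Deleting an edge of a connected graph leaves every vertex connected to one of its ends. -/
theorem Connected.reachable_or_reachable_deleteEdges {G : SimpleGraph V} (hG : G.Connected)
    (a b x : V) :
    (G.deleteEdges {s(a, b)}).Reachable a x ∨ (G.deleteEdges {s(a, b)}).Reachable b x := by
  obtain ⟨p⟩ := hG.preconnected x a
  induction p with
  | nil => exact Or.inl (Reachable.refl _)
  | @cons u v w h p ih =>
    by_cases he : s(u, v) = s(w, b)
    · rcases Sym2.eq_iff.1 he with ⟨rfl, rfl⟩ | ⟨rfl, rfl⟩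
      · exact Or.inl (Reachable.refl _)
      · exact Or.inr (Reachable.refl _)
    · have hvu : (G.deleteEdges {s(w, b)}).Reachable v u :=
        Adj.reachable (by rw [deleteEdges_adj]; exact ⟨h.symm, by rwa [Sym2.eq_swap (a := v)]⟩)
      exact ih.imp (·.trans hvu) (·.trans hvu)

/-- Replacing an edge of a connected graph by one that joins the two sides preserves
connectedness. -/
theorem Connected.deleteEdges_sup_edge {G : SimpleGraph V} (hG : G.Connected) (e : Sym2 V)
    {u v : V} (huv : ¬ (G.deleteEdges {e}).Reachable u v) :
    (G.deleteEdges {e} ⊔ edge u v).Connected := by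
  induction e with
  | h a b =>
    have := hG.nonempty
    set H := G.deleteEdges {s(a, b)}
    have hle : H ≤ H ⊔ edge u v := le_sup_left
    have huv' : (H ⊔ edge u v).Reachable u v := by
      have hne : u ≠ v := fun h => huv (h ▸ Reachable.refl _)
      exact Adj.reachable (Or.inr (by simp [edge_adj, hne]))
    have hab : (H ⊔ edge u v).Reachable a b := by
      rcases hG.reachable_or_reachable_deleteEdges a b u with hu | hu <;>
        rcases hG.reachable_or_reachable_deleteEdges a b v with hv | hv
      · exact absurd (hu.symm.trans hv) huv
      · exact (hu.mono hle).trans (huv'.trans (hv.mono hle).symm)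
      · exact (hv.mono hle).trans (huv'.symm.trans (hu.mono hle).symm)
      · exact absurd (hu.symm.trans hv) huv
    have key : ∀ x, (H ⊔ edge u v).Reachable a x := fun x =>
      (hG.reachable_or_reachable_deleteEdges a b x).elim (·.mono hle)
        (fun h => hab.trans (h.mono hle))
    exact ⟨fun x y => (key x).symm.trans (key y)⟩

/-- A finite nonempty vertex set with positive weights on pairs has a minimum spanning tree. -/
theorem exists_isAcyclic_weight_le [Finite V] [Nonempty V] (w : Sym2 V → ℝ)
    (hw : ∀ u v, u ≠ v → 0 < w s(u, v)) :
    ∃ G : SimpleGraph V, G.Connected ∧ G.IsAcyclic ∧ ∀ e ∈ G.edgeSet, ∀ u v,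
      ¬ (G.deleteEdges {e}).Reachable u v → w e ≤ w s(u, v) := by
  classical
  have := Fintype.ofFinite V
  -- Minimizing over all connected graphs suffices: positive weights exclude cycles, since deleting
  -- a non-bridge edge would be cheaper.
  obtain ⟨G, hG, hmin⟩ := Set.exists_min_image {G : SimpleGraph V | G.Connected}
    (fun G => ∑ e ∈ G.edgeFinset, w e) (Set.toFinite _) ⟨⊤, connected_top⟩
  have hdel : ∀ e ∈ G.edgeSet,
      ∑ f ∈ (G.deleteEdges {e}).edgeFinset, w f = (∑ f ∈ G.edgeFinset, w f) - w e := by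
    intro e he
    rw [← Finset.sum_erase_eq_sub (mem_edgeFinset.2 he)]
    refine Finset.sum_congr ?_ fun _ _ => rfl
    ext f
    simp [and_comm]
  refine ⟨G, hG, ?_, ?_⟩
  · rw [isAcyclic_iff_forall_adj_isBridge]
    intro a b hab
    by_contra hbr
    have h1 : ∑ f ∈ G.edgeFinset, w f ≤ ∑ f ∈ (G.deleteEdges {s(a, b)}).edgeFinset, w f := by
      refine (hmin _ (hG.connected_delete_edge_of_not_isBridge hbr)).trans_eq ?_
      congr!
    have h2 := hdel s(a, b) hab
    have h3 := hw a b hab.ne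
    linarith
  · intro e he u v huv
    have h1 : ∑ f ∈ G.edgeFinset, w f ≤
        ∑ f ∈ (G.deleteEdges {e} ⊔ edge u v).edgeFinset, w f := by
      refine (hmin _ (hG.deleteEdges_sup_edge e huv)).trans_eq ?_
      congr!
    have h2 := hdel e he
    have hne : u ≠ v := fun h => huv (h ▸ Reachable.refl _)
    have h3 : ∑ f ∈ (G.deleteEdges {e} ⊔ edge u v).edgeFinset, w f ≤
        (∑ f ∈ (G.deleteEdges {e}).edgeFinset, w f) + w s(u, v) := by
      have hni : s(u, v) ∉ (G.deleteEdges {e}).edgeFinset := by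
        rw [mem_edgeFinset]
        exact fun h => huv (Adj.reachable h)
      rw [add_comm, ← Finset.sum_insert hni]
      refine le_of_eq (Finset.sum_congr ?_ fun _ _ => rfl)
      ext f
      simp [edgeSet_edge_of_ne hne, or_comm]
    linarith

/-- In an acyclic graph, deleting an edge of a path separates the ends of the path. -/
theorem IsAcyclic.not_reachable_deleteEdges_of_mem_edges {G : SimpleGraph V} (hG : G.IsAcyclic)
    {u v : V} {p : G.Walk u v} (hp : p.IsPath) {e : Sym2 V} (he : e ∈ p.edges) :
    ¬ (G.deleteEdges {e}).Reachable u v := by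
  intro h
  obtain ⟨q, hq⟩ := h.exists_isPath
  have hle : G.deleteEdges {e} ≤ G := deleteEdges_le _
  have hqp : q.mapLe hle = p :=
    congrArg Subtype.val ((hG.subsingleton_path u v).elim ⟨q.mapLe hle, hq.mapLe hle⟩ ⟨p, hp⟩)
  rw [← hqp, Walk.edges_mapLe_eq_edges] at he
  have := q.edges_subset_edgeSet he
  simp at this

/-- If some edges are deleted from a tree, then for a vertex `u` and a vertex `v` outside its new
component there is a deleted edge that leaves this component and separates `u` from `v`. -/
theorem IsAcyclic.exists_boundary_edge {G : SimpleGraph V} (hG : G.IsAcyclic) (hc : G.Connected)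
    (F : Set (Sym2 V)) {u v : V} (huv : ¬ (G.deleteEdges F).Reachable u v) :
    ∃ a b, G.Adj a b ∧ s(a, b) ∈ F ∧ (G.deleteEdges F).Reachable u a ∧
      ¬ (G.deleteEdges {s(a, b)}).Reachable u v := by
  obtain ⟨p, hp⟩ := (hc.preconnected u v).exists_isPath
  obtain ⟨d, hd, ha, hb⟩ := p.exists_boundary_dart {x | (G.deleteEdges F).Reachable u x}
    (Reachable.refl _) huv
  refine ⟨d.fst, d.snd, d.adj, ?_, ha,
    hG.not_reachable_deleteEdges_of_mem_edges hp (List.mem_map_of_mem hd)⟩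
  by_contra hF
  exact hb (Reachable.trans ha (Adj.reachable (by rw [deleteEdges_adj]; exact ⟨d.adj, hF⟩)))

theorem Adj.card_connectedComponent_lt_deleteEdges [Finite V] {G : SimpleGraph V} {a b : V}
    (hab : G.Adj a b) (h : ¬ (G.deleteEdges {s(a, b)}).Reachable a b) :
    Nat.card G.ConnectedComponent < Nat.card (G.deleteEdges {s(a, b)}).ConnectedComponent := by
  classical
  have := Fintype.ofFinite V
  have := Fintype.ofFinite G.ConnectedComponent
  have := Fintype.ofFinite (G.deleteEdges {s(a, b)}).ConnectedComponent
  rw [Nat.card_eq_fintype_card, Nat.card_eq_fintype_card]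
  have hle : G.deleteEdges {s(a, b)} ≤ G := deleteEdges_le _
  refine Fintype.card_lt_of_surjective_not_injective
    (ConnectedComponent.map (Hom.ofLE hle)) (ConnectedComponent.surjective_map_ofLE hle) ?_
  intro hinj
  refine h (ConnectedComponent.eq.1 (hinj ?_))
  simpa using hab.reachable

theorem IsAcyclic.card_add_card_connectedComponent_le [Finite V] {G : SimpleGraph V}
    (hG : G.IsAcyclic) (F : Finset (Sym2 V)) (hF : (F : Set (Sym2 V)) ⊆ G.edgeSet) :
    F.card + Nat.card G.ConnectedComponent ≤
      Nat.card (G.deleteEdges (F : Set (Sym2 V))).ConnectedComponent := by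
  classical
  induction F using Finset.induction_on with
  | empty => simp
  | insert e F he ih =>
    rw [Finset.coe_insert, Set.insert_subset_iff] at hF
    have ih := ih hF.2
    induction e with
    | h a b =>
      have hadj : (G.deleteEdges (F : Set (Sym2 V))).Adj a b := by
        rw [deleteEdges_adj]
        exact ⟨hF.1, he⟩
      have hac : (G.deleteEdges (F : Set (Sym2 V))).IsAcyclic := hG.anti (deleteEdges_le _)
      have hlt := Adj.card_connectedComponent_lt_deleteEdges hadj
        (hac.not_reachable_deleteEdges_of_mem_edges (p := hadj.toWalk)
          (Walk.IsPath.of_adj hadj) (by simp))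
      rw [deleteEdges_deleteEdges, Set.union_singleton] at hlt
      rw [Finset.card_insert_of_notMem he, Finset.coe_insert]
      omega

end SimpleGraph

/-! ### Diametral disks and angles -/

open scoped InnerProductSpace

/-- Thales: the disk consists of the points that see `pq` at a right or obtuse angle, with the
endpoints included. -/
theorem mem_diametralDisk_iff {p q z : Plane} :
    z ∈ diametralDisk p q ↔ ⟪p - z, q - z⟫_ℝ ≤ 0 := by
  have hm : z - midpoint ℝ p q = -(1 / 2 : ℝ) • ((p - z) + (q - z)) := by
    rw [midpoint_eq_smul_add, invOf_eq_inv]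
    module
  have hd : p - q = (p - z) - (q - z) := by abel
  rw [diametralDisk, Metric.mem_closedBall, dist_eq_norm, dist_eq_norm, hm, hd, norm_smul]
  have h1 := norm_add_sq_real (p - z) (q - z)
  have h2 := norm_sub_sq_real (p - z) (q - z)
  have h3 : ‖(-(1 / 2) : ℝ)‖ = 1 / 2 := by norm_num
  rw [h3]
  constructor
  · intro h
    have := pow_le_pow_left₀ (norm_nonneg _)
      (show ‖(p - z) + (q - z)‖ ≤ ‖(p - z) - (q - z)‖ by linarith) 2
    linarith
  · intro h
    have := (sq_le_sq₀ (norm_nonneg ((p - z) + (q - z))) (norm_nonneg ((p - z) - (q - z)))).1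
      (by linarith)
    linarith

/-- Vectors in the half-plane `⟪u, ·⟫ ≤ 0` that pairwise make angles greater than `π / 3`. -/
theorem card_le_three_of_inner_lt {ι : Type*} (s : Finset ι) (u : Plane) (hu : u ≠ 0)
    (v : ι → Plane) (huv : ∀ i ∈ s, ⟪u, v i⟫_ℝ ≤ 0)
    (hv : ∀ i ∈ s, ∀ j ∈ s, i ≠ j → 2 * ⟪v i, v j⟫_ℝ < ‖v i‖ ^ 2) : s.card ≤ 3 := by
  by_contra! hcard
  -- In complex notation `z i` is -i · conj(u) · v i, so the half-plane becomes the closed upper one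
  -- and arguments lie in [0, π].
  let z : ι → ℂ := fun i => ⟨u 0 * v i 1 - u 1 * v i 0, -⟪u, v i⟫_ℝ⟩
  have hu2 : 0 < ‖u‖ ^ 2 := by positivity
  have hin : ∀ a b : Plane, ⟪a, b⟫_ℝ = a 0 * b 0 + a 1 * b 1 := by
    intro a b
    simp [PiLp.inner_apply, Fin.sum_univ_two, mul_comm]
  have hn : ∀ a : Plane, ‖a‖ ^ 2 = a 0 * a 0 + a 1 * a 1 := by
    intro a
    rw [← real_inner_self_eq_norm_sq, hin]
  have hz : ∀ i j, (z i).re * (z j).re + (z i).im * (z j).im = ‖u‖ ^ 2 * ⟪v i, v j⟫_ℝ := by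
    intro i j
    simp only [z, hin, hn]
    ring
  have hzn : ∀ i, ‖z i‖ ^ 2 = ‖u‖ ^ 2 * ‖v i‖ ^ 2 := by
    intro i
    rw [← real_inner_self_eq_norm_sq (v i), ← hz, Complex.sq_norm, Complex.normSq_apply]
  have hcos : ∀ i ∈ s, ∀ j ∈ s, i ≠ j → Real.pi / 3 < |(z i).arg - (z j).arg| := by
    intro i hi j hj hij
    by_contra! hle
    have hc : 1 / 2 ≤ Real.cos ((z i).arg - (z j).arg) := by
      rw [← Real.cos_abs, ← Real.cos_pi_div_three]
      exact Real.cos_le_cos_of_nonneg_of_le_pi (abs_nonneg _)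
        (by linarith [Real.pi_pos]) hle
    have hprod : ‖z i‖ * ‖z j‖ * Real.cos ((z i).arg - (z j).arg) =
        ‖u‖ ^ 2 * ⟪v i, v j⟫_ℝ := by
      rw [← hz, Real.cos_sub, ← Complex.norm_mul_cos_arg (z i), ← Complex.norm_mul_cos_arg (z j),
        ← Complex.norm_mul_sin_arg (z i), ← Complex.norm_mul_sin_arg (z j)]
      ring
    -- An angle of at most π/3 makes twice the inner product at least the product of the norms,
    -- hence at least the smaller squared norm.
    have h0 : 0 ≤ ‖z i‖ * ‖z j‖ := by positivity
    have h1 : ‖z i‖ * ‖z j‖ ≤ 2 * (‖u‖ ^ 2 * ⟪v i, v j⟫_ℝ) := by nlinarith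
    have h2 := mul_lt_mul_of_pos_left (hv i hi j hj hij) hu2
    have h3 := mul_lt_mul_of_pos_left (hv j hj i hi hij.symm) hu2
    rw [real_inner_comm] at h3
    have h4 := hzn i
    have h5 := hzn j
    rcases le_total ‖z i‖ ‖z j‖ with h | h
    · nlinarith [norm_nonneg (z i)]
    · nlinarith [norm_nonneg (z j)]
  have hpi := Real.pi_pos
  -- Two of four arguments share a third of [0, π].
  let f : ι → Fin 3 := fun i =>
    if (z i).arg ≤ Real.pi / 3 then 0 else if (z i).arg ≤ 2 * (Real.pi / 3) then 1 else 2
  obtain ⟨i, hi, j, hj, hij, hf⟩ := Finset.exists_ne_map_eq_of_card_lt_of_maps_to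
    (s := s) (t := Finset.univ) (f := f) (by simpa using hcard) (fun _ _ => Finset.mem_univ _)
  have hlt := hcos i hi j hj hij
  have harg : ∀ i ∈ s, 0 ≤ (z i).arg := fun i hi =>
    Complex.arg_nonneg_iff.2 (neg_nonneg.2 (huv i hi))
  have hi0 := harg i hi
  have hj0 := harg j hj
  have hip := (z i).arg_le_pi
  have hjp := (z j).arg_le_pi
  refine absurd hlt (not_lt.2 (abs_le.2 ?_))
  simp only [f] at hf
  split_ifs at hf <;> first | (constructor <;> linarith) | simp at hf

/-- The diametral disks of at most three edges of a minimum spanning tree contain a given point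
that is not a vertex. -/
theorem card_edges_diametralDisk_le_three {P : Finset Plane} {G : SimpleGraph P}
    (hc : G.Connected) (hG : G.IsAcyclic)
    (hmin : ∀ a b, G.Adj a b → ∀ u v, ¬ (G.deleteEdges {s(a, b)}).Reachable u v →
      dist (a : Plane) b ≤ dist (u : Plane) v)
    {x : Plane} (hx : x ∉ P) (F : Finset (Sym2 P)) (hF : (F : Set (Sym2 P)) ⊆ G.edgeSet)
    (hFx : ∀ a b, s(a, b) ∈ F → x ∈ diametralDisk (a : Plane) b) : F.card ≤ 3 := by
  classical
  set H := G.deleteEdges (F : Set (Sym2 P)) with hH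
  have := hc.nonempty
  have := Fintype.ofFinite H.ConnectedComponent
  obtain ⟨c, hcmin⟩ := Finite.exists_min (fun a : P => ‖(a : Plane) - x‖)
  have hcard : F.card + 1 ≤ Fintype.card H.ConnectedComponent := by
    have h1 := hG.card_add_card_connectedComponent_le F hF
    rw [← hH] at h1
    have h2 : 0 < Nat.card G.ConnectedComponent := by
      have : Nonempty G.ConnectedComponent := ⟨G.connectedComponentMk c⟩
      exact Nat.card_pos
    rw [← Nat.card_eq_fintype_card]
    omega
  have hrep : ∀ C : H.ConnectedComponent, ∃ p : P, H.connectedComponentMk p = C ∧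
      ∀ a, H.connectedComponentMk a = C → ‖(p : Plane) - x‖ ≤ ‖(a : Plane) - x‖ := by
    intro C
    obtain ⟨p, hp, hpm⟩ := Set.exists_min_image {a | H.connectedComponentMk a = C}
      (fun a : P => ‖(a : Plane) - x‖) (Set.toFinite _) C.exists_rep
    exact ⟨p, hp, hpm⟩
  choose r hrC hrmin using hrep
  have hcpos : 0 < ‖(c : Plane) - x‖ := norm_pos_iff.2 (sub_ne_zero.2 fun h => hx (h ▸ c.2))
  have key : ∀ C D, C ≠ D →
      2 * ⟪(r C : Plane) - x, (r D : Plane) - x⟫_ℝ ≤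
        ‖(r D : Plane) - x‖ ^ 2 - ‖(c : Plane) - x‖ ^ 2 := by
    intro C D hCD
    have hnr : ¬ H.Reachable (r C) (r D) := fun h =>
      hCD ((hrC C).symm.trans ((SimpleGraph.ConnectedComponent.eq.2 h).trans (hrC D)))
    -- With norms measured from `x`: |r C|² + |c|² ≤ |a|² + |b|² ≤ |ab|² ≤ |r C - r D|². The second
    -- inequality is membership of `x` in the disk, the third the exchange property.
    obtain ⟨a, b, hab, habF, hra, hsep⟩ := hG.exists_boundary_edge hc _ hnr
    have hle := hmin a b hab _ _ hsep
    have ha := hrmin C a (by rw [← hrC C]; exact (SimpleGraph.ConnectedComponent.eq.2 hra).symm)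
    have hb := hcmin b
    have hd := mem_diametralDisk_iff.1 (hFx a b habF)
    have hsub : ∀ p q : Plane, dist p q ^ 2 =
        ‖p - x‖ ^ 2 - 2 * ⟪p - x, q - x⟫_ℝ + ‖q - x‖ ^ 2 := by
      intro p q
      rw [dist_eq_norm, ← sub_sub_sub_cancel_right p q x, norm_sub_sq_real]
    have hle2 := pow_le_pow_left₀ dist_nonneg hle 2
    rw [hsub, hsub] at hle2
    have ha2 := pow_le_pow_left₀ (norm_nonneg _) ha 2
    have hb2 := pow_le_pow_left₀ (norm_nonneg _) hb 2
    linarith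
  set C₀ := H.connectedComponentMk c
  have hr0 : ‖(r C₀ : Plane) - x‖ = ‖(c : Plane) - x‖ :=
    le_antisymm (hrmin C₀ c rfl) (hcmin _)
  -- Taking `D = C₀` in `key` makes the inner product nonpositive; for other pairs the positive term
  -- ‖c - x‖² gives strictness.
  have h3 := card_le_three_of_inner_lt (Finset.univ.erase C₀) ((r C₀ : Plane) - x)
    (norm_pos_iff.1 (hr0 ▸ hcpos)) (fun C => (r C : Plane) - x)
    (fun C hC => by
      have := key C C₀ (Finset.ne_of_mem_erase hC)
      rw [hr0, real_inner_comm] at this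
      linarith)
    (fun C _ D _ hCD => by
      have := key D C hCD.symm
      rw [real_inner_comm] at this
      nlinarith)
  rw [Finset.card_erase_of_mem (Finset.mem_univ _), Finset.card_univ] at h3
  omega

/-! ### The lower bound -/

theorem BlocksGabriel.exists_mem {P K : Set Plane} (h : BlocksGabriel P K) {p q : Plane}
    (hp : p ∈ P) (hq : q ∈ P) (hpq : p ≠ q) :
    ∃ z ∈ P ∪ K, z ≠ p ∧ z ≠ q ∧ z ∈ diametralDisk p q := by
  by_contra! hz
  have hne : (⟨p, Or.inl hp⟩ : (P ∪ K : Set Plane)) ≠ ⟨q, Or.inl hq⟩ :=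
    fun h => hpq (congrArg Subtype.val h)
  refine h (x := ⟨p, Or.inl hp⟩) hp (y := ⟨q, Or.inl hq⟩) hq hne ⟨hne, ?_⟩
  simp only [Nat.cast_zero, nonpos_iff_eq_zero, Set.encard_eq_zero]
  ext z
  simp only [Set.mem_inter_iff, Set.mem_sdiff, Set.mem_insert_iff, Set.mem_singleton_iff, not_or,
    Set.mem_empty_iff_false, iff_false]
  exact fun hzz => hz z hzz.1.1 hzz.1.2.1 hzz.1.2.2 hzz.2

theorem blocksGabriel_of_exists_mem {P K : Set Plane}
    (h : ∀ p ∈ P, ∀ q ∈ P, p ≠ q → ∃ z ∈ P ∪ K, z ≠ p ∧ z ≠ q ∧ z ∈ diametralDisk p q) :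
    BlocksGabriel P K := by
  rintro ⟨p, _⟩ hp ⟨q, _⟩ hq hpq ⟨_, hadj⟩
  obtain ⟨z, hz, hzp, hzq, hzd⟩ := h p hp q hq (by simpa using hpq)
  simp only [Nat.cast_zero, nonpos_iff_eq_zero, Set.encard_eq_zero] at hadj
  exact Set.notMem_empty z (hadj ▸ ⟨⟨hz, by simp [hzp, hzq]⟩, hzd⟩)

/-- The non-acute angle at `z` gives |pz|² + |qz|² ≤ |pq|². -/
theorem dist_lt_of_mem_diametralDisk {p q z : Plane} (hz : z ∈ diametralDisk p q) (hzq : z ≠ q) :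
    dist p z < dist p q := by
  have hd := mem_diametralDisk_iff.1 hz
  have h : 0 < ‖q - z‖ := norm_pos_iff.2 (sub_ne_zero.2 hzq.symm)
  have h2 := norm_sub_sq_real (p - z) (q - z)
  rw [sub_sub_sub_cancel_right] at h2
  rw [dist_eq_norm, dist_eq_norm]
  exact lt_of_pow_lt_pow_left₀ 2 (norm_nonneg _) (by nlinarith)

theorem BlocksGabriel.card_le {P K : Finset Plane}
    (h : BlocksGabriel (P : Set Plane) (K : Set Plane)) : P.card ≤ 3 * K.card + 1 := by
  classical
  rcases P.eq_empty_or_nonempty with rfl | ⟨p₀, hp₀⟩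
  · simp
  have : Nonempty P := ⟨⟨p₀, hp₀⟩⟩
  obtain ⟨G, hc, hG, hmin⟩ := SimpleGraph.exists_isAcyclic_weight_le (V := P)
    (Sym2.lift ⟨fun a b => dist (a : Plane) b, fun a b => dist_comm _ _⟩)
    (fun u v huv => by simpa [sub_eq_zero] using huv)
  have hmin' : ∀ a b, G.Adj a b → ∀ u v, ¬ (G.deleteEdges {s(a, b)}).Reachable u v →
      dist (a : Plane) b ≤ dist (u : Plane) v := fun a b hab u v huv => hmin s(a, b) hab u v huv
  have hK : ∀ e ∈ G.edgeFinset, ∃ x ∈ K, x ∉ P ∧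
      ∀ a b, s(a, b) = e → x ∈ diametralDisk (a : Plane) b := by
    intro e he
    induction e with
    | h a b =>
      have hab : G.Adj a b := by simpa using he
      obtain ⟨z, hz, hza, hzb, hzd⟩ := h.exists_mem a.2 b.2 (by simpa using hab.ne)
      have hzP : z ∉ P := by
        intro hzP
        have hsep : ¬ (G.deleteEdges {s(a, b)}).Reachable a b :=
          hG.not_reachable_deleteEdges_of_mem_edges (p := hab.toWalk)
            (SimpleGraph.Walk.IsPath.of_adj hab) (by simp)
        -- Whichever side of the cut contains `z`, joining `z` to the opposite endpoint reconnects
        -- the tree by an edge shorter than `ab`.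
        by_cases haz : (G.deleteEdges {s(a, b)}).Reachable a ⟨z, hzP⟩
        · refine (hmin' a b hab b ⟨z, hzP⟩ fun hbz => hsep (haz.trans hbz.symm)).not_gt ?_
          rw [dist_comm (a : Plane)]
          exact dist_lt_of_mem_diametralDisk (diametralDisk_comm (a : Plane) b ▸ hzd) hza
        · exact (hmin' a b hab a ⟨z, hzP⟩ haz).not_gt (dist_lt_of_mem_diametralDisk hzd hzb)
      refine ⟨z, hz.resolve_left hzP, hzP, fun a' b' hab' => ?_⟩
      rcases Sym2.eq_iff.1 hab' with ⟨rfl, rfl⟩ | ⟨rfl, rfl⟩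
      · exact hzd
      · rwa [diametralDisk_comm]
  choose! f hfK hfP hfd using hK
  have hE : P.card ≤ G.edgeFinset.card + 1 := by
    have := hc.card_vert_le_card_edgeSet_add_one
    simpa [SimpleGraph.edgeFinset_card, Nat.card_eq_fintype_card] using this
  have hle : G.edgeFinset.card ≤ 3 * K.card := by
    refine Finset.card_le_mul_card_image_of_maps_to hfK 3 fun x _ => ?_
    rcases (G.edgeFinset.filter (f · = x)).eq_empty_or_nonempty with h0 | ⟨e, he⟩
    · rw [h0]
      simp
    · have hx : x ∉ P := by
        rw [Finset.mem_filter] at he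
        exact he.2 ▸ hfP e he.1
      refine card_edges_diametralDisk_le_three hc hG hmin' hx _ (fun e he => ?_) fun a b he => ?_
      · simp only [Finset.coe_filter, Set.mem_ofPred_eq, SimpleGraph.mem_edgeFinset] at he
        exact he.1
      · rw [Finset.mem_filter] at he
        exact he.2 ▸ hfd _ he.1 a b rfl
  omega

/-! ### The tight example -/

/-- The point of the plane with the given integer coordinates. -/
noncomputable def latticePoint (a : ℤ × ℤ) : Plane := !₂[(a.1 : ℝ), (a.2 : ℝ)]

theorem latticePoint_injective : Function.Injective latticePoint := by
  intro a b h
  have h0 := congrFun (congrArg WithLp.ofLp h) 0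
  have h1 := congrFun (congrArg WithLp.ofLp h) 1
  simp only [latticePoint, Matrix.cons_val_zero, Matrix.cons_val_one, Int.cast_inj] at h0 h1
  exact Prod.ext h0 h1

theorem latticePoint_mem_diametralDisk {a b c : ℤ × ℤ}
    (h : (a.1 - c.1) * (b.1 - c.1) + (a.2 - c.2) * (b.2 - c.2) ≤ 0) :
    latticePoint c ∈ diametralDisk (latticePoint a) (latticePoint b) := by
  rw [mem_diametralDisk_iff]
  have : ((((a.1 - c.1) * (b.1 - c.1) + (a.2 - c.2) * (b.2 - c.2) : ℤ)) : ℝ) ≤ 0 := by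
    exact_mod_cast h
  push_cast at this
  simpa [latticePoint, PiLp.inner_apply, Fin.sum_univ_two, mul_comm] using this

/-- Four collinear crosses, consecutive ones sharing a tip: the tips. -/
def crossTips : Finset (ℤ × ℤ) :=
  {(-1, 0), (1, 0), (3, 0), (5, 0), (7, 0), (0, 1), (2, 1), (4, 1), (6, 1),
    (0, -1), (2, -1), (4, -1), (6, -1)}

/-- The centers of the crosses. -/
def crossCenters : Finset (ℤ × ℤ) := {(0, 0), (2, 0), (4, 0), (6, 0)}

/-- Tips block one another too: the circle with diameter from (0, 1) to (2, 1) passes through the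
shared tip (1, 0). In integer coordinates the condition is a finite check. -/
theorem exists_mem_cross : ∀ a ∈ crossTips, ∀ b ∈ crossTips, a ≠ b →
    ∃ c ∈ crossTips ∪ crossCenters, c ≠ a ∧ c ≠ b ∧
      (a.1 - c.1) * (b.1 - c.1) + (a.2 - c.2) * (b.2 - c.2) ≤ 0 := by
  decide +kernel

theorem mainTheorem7 :
    (∀ P K : Finset Plane, BlocksGabriel (P : Set Plane) (K : Set Plane) →
      ⌈((P.card : ℝ) - 1) / 3⌉ ≤ (K.card : ℤ)) ∧
    (∃ P K : Finset Plane, P.card = 13 ∧ Disjoint P K ∧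
      BlocksGabriel (P : Set Plane) (K : Set Plane) ∧
      (K.card : ℤ) = ⌈((P.card : ℝ) - 1) / 3⌉) := by
  constructor
  · intro P K h
    rw [Int.ceil_le]
    have : (P.card : ℝ) ≤ 3 * K.card + 1 := by exact_mod_cast h.card_le
    push_cast
    linarith
  · let φ : ℤ × ℤ ↪ Plane := ⟨latticePoint, latticePoint_injective⟩
    have hP : (crossTips.map φ).card = 13 := by rw [Finset.card_map]; decide
    have hK : (crossCenters.map φ).card = 4 := by rw [Finset.card_map]; decide
    refine ⟨crossTips.map φ, crossCenters.map φ, hP, ?_, ?_, ?_⟩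
    · rw [Finset.disjoint_map]
      decide
    · refine blocksGabriel_of_exists_mem fun p hp q hq hpq => ?_
      obtain ⟨a, ha, rfl⟩ := Finset.mem_map.1 hp
      obtain ⟨b, hb, rfl⟩ := Finset.mem_map.1 hq
      obtain ⟨c, hc, hca, hcb, hcab⟩ := exists_mem_cross a ha b hb fun h => hpq (h ▸ rfl)
      refine ⟨φ c, ?_, φ.injective.ne hca, φ.injective.ne hcb,
        latticePoint_mem_diametralDisk hcab⟩
      rw [← Finset.coe_union, ← Finset.map_union]
      exact Finset.mem_map_of_mem φ hc
    · rw [hP, hK]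
      norm_num
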